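/- **Network.** Let $\mathcal M$ be a finite non-empty set of locations and $n\ge 1$ the number of full-time drivers (FDs). Requests arrive at $i$ as a Poisson process of rate $\lambda_i^R\ge 0$ and have destination $j$ with probability $P^R_{ij}$ ($\sum_j P^R_{ij}=1$). Crowdsourced drivers of kind $\beta\in\{\mathrm{GW},\mathrm{OD}\}$ (gig workers, occasional drivers) arrive for the route $i\to j$ at rate $\lambda_i^\beta P_{ij}^\beta\ge 0$. Travel times from $i$ to $j$ are exponential with rate $\mu_{ij}>0$. Let $c^{FD}_{ij},c^{GW}_{ij},c^{OD}_{ij},c^{\emptyset}_{ij}$ be real costs, where $\emptyset$ stands for an unmatched request. The network is a continuous-time Markov chain. Its state consists of the number $E_{ii}$ of FDs idling at $i$, the number $E_{ij}$ ($i\ne j$) of FDs relocating empty from $i$ to $j$, the number $F_{ij}$ of FDs serving a request from $i$ to $j$, with $\sum_{i,j}(E_{ij}+F_{ij})=n$, and the numbers of crowdsourced drivers of each kind waiting on each route. A policy may be randomized and depend on the current state, as follows. * A request arriving at $i$ is given to an idle FD at $i$ (only if $E_{ii}>0$) with a probability that does not depend on its destination. Giving it to an FD whenever $E_{ii}>0$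 makes $E_{ii}$ a single-server queue with service rate $\lambda_i^R$. * A request from $i$ to $j$ may instead be given to a crowdsourced driver waiting on the route $i\to j$. Otherwise it is lost. * An FD that finishes a service at $i$ is sent to $j$ with probability $Q_{ij}$, where $\sum_jQ_{ij}=1$ and $j=i$ means idling at $i$. An FD that finishes a relocation from $i$ to $j$ idles at $j$. Arriving crowdsourced drivers may wait or leave at once, with arbitrary state-dependent probabilities, and waiting ones give up at arbitrary state-dependent rates. The steady-state operational cost (per unit of time) is the expectation, under a stationary distribution of the chain, of $$\sum_{i,j}\Big[\lambda_i^RP^R_{ij}\Big(c^{FD}_{ij}m^{FD}_i+\sum_{\beta\in\{\mathrm{GW},\mathrm{OD}\}}c^\beta_{ij}m^\beta_{ij}+c^\emptyset_{ij}\big(1-m^{FD}_i-\sum_{\beta\in\{\mathrm{GW},\mathrm{OD}\}} m^\beta_{ij}\big)\Big)+(1-\delta_{ij})c^{FD}_{ij}E_{ij}\Big],$$ where $m^{FD}_i,m^\beta_{ij}$ are the probabilities, in the current state, with which the policy gives an arriving request to an FD or to a driver of kind $\beta$. **Fluid linear program.** Minimize, over real $e_{ij},f_{ij},a_i^{FD},a_{ij}^{GW},a_{ij}^{OD},a_{ij}^\emptyset$,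 $$\sum_{i,j}\Big[\lambda_i^R\Big(\sum_{\beta\in\{\mathrm{GW},\mathrm{OD},\emptyset\}}c^\beta_{ij}a^\beta_{ij}+c^{FD}_{ij}P^R_{ij}a^{FD}_i\Big)+(1-\delta_{ij})c^{FD}_{ij}\,n\,e_{ij}\Big]$$ subject to, for all $i,j\in\mathcal M$, $$\tfrac{\lambda^R_i}{n}a^{FD}_iP^R_{ij}=\mu_{ij}f_{ij},\qquad \lambda^R_ia^{GW}_{ij}\le\lambda^{GW}_iP^{GW}_{ij},\qquad \lambda^R_ia^{OD}_{ij}\le\lambda^{OD}_iP^{OD}_{ij},$$ $$\mu_{ij}e_{ij}\le\sum_k\mu_{ki}f_{ki}\ (i\ne j),\qquad \sum_{k\ne i}\mu_{ki}e_{ki}\le\tfrac{\lambda^R_i}{n}a_i^{FD}\le\sum_{k\ne i}\mu_{ki}e_{ki}+\sum_k\mu_{ki}f_{ki},$$ $$\tfrac{\lambda^R_i}{n}a_i^{FD}+\sum_{j\ne i}\mu_{ij}e_{ij}=\sum_{k\ne i}\mu_{ki}e_{ki}+\sum_k\mu_{ki}f_{ki},\qquad a_i^{FD}+\sum_j\big(a^{GW}_{ij}+a^{OD}_{ij}+a^\emptyset_{ij}\big)=1,$$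 $$0\le a_i^{FD}\le1,\quad 0\le a^{GW}_{ij},a^{OD}_{ij}\le P^R_{ij},\quad 0\le a^\emptyset_{ij}\le1,\quad 0\le e_{ij},f_{ij}\le1,\quad \sum_{i,j}(e_{ij}+f_{ij})=1.$$ **Proposition.** For every such network, the linear program has an optimal value $v$ (it is attained), and $v$ is at most the operational cost of every stationary distribution under every policy. In particular, this lower bound holds asymptotically: for every sequence of networks on $\mathcal M$ with $n\to\infty$ and $\lambda_i^R\to\infty$ for all $i$, and any choice of policies and stationary distributions, the optimal value of the linear program is eventually at most the steady-state operational cost. -/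

import Mathlib

open Filter

namespace DeliveryNetwork

/-- The two kinds of crowdsourced drivers: gig workers and occasional drivers. -/
inductive Crowd
  | gigWorker
  | occasional
  deriving DecidableEq

instance : Fintype Crowd where
  elems := {.gigWorker, .occasional}
  complete := by intro β; cases β <;> simp

/-- The data of the operational problem on a finite set `M` of locations.  Costs may be any reals.
* `n`: number of full-time drivers (FDs);
* `reqRate i`, `reqProb i j`: arrival rate of requests at `i`, probability that such a request
  has destination `j`;
* `crowdRate β i`, `crowdProb β i j`: arrival rate of crowdsourced drivers of kind `β` at `i`,
  probability that such a driver is available for the route from `i` to `j`;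
* `mu i j`: reciprocal of the mean travel time from `i` to `j`;
* `costFD`, `costCrowd β`, `costLost`: route dependent costs of an FD, of a crowdsourced driver of
  kind `β`, and of a request that is not matched. -/
structure Network (M : Type*) [Fintype M] where
  n : ℕ
  n_pos : 0 < n
  reqRate : M → ℝ
  reqRate_nonneg : ∀ i, 0 ≤ reqRate i
  reqProb : M → M → ℝ
  reqProb_nonneg : ∀ i j, 0 ≤ reqProb i j
  reqProb_sum : ∀ i, ∑ j, reqProb i j = 1
  crowdRate : Crowd → M → ℝ
  crowdRate_nonneg : ∀ β i, 0 ≤ crowdRate β i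
  crowdProb : Crowd → M → M → ℝ
  crowdProb_nonneg : ∀ β i j, 0 ≤ crowdProb β i j
  mu : M → M → ℝ
  mu_pos : ∀ i j, 0 < mu i j
  costFD : M → M → ℝ
  costCrowd : Crowd → M → M → ℝ
  costLost : M → M → ℝ

/-! ### The fluid linear program -/

/-- The variables `e`, `f`, `a^FD`, `a^GW` and `a^OD`, `a^∅` of the linear program. -/
structure FluidVars (M : Type*) where
  e : M → M → ℝ
  f : M → M → ℝ
  aFD : M → ℝ
  aCrowd : Crowd → M → M → ℝ
  aLost : M → M → ℝ

section LP

variable {M : Type*} [Fintype M] [DecidableEq M]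

/-- The constraints of the fluid linear program. -/
structure Network.Feasible (D : Network M) (z : FluidVars M) : Prop where
  little_fd : ∀ i j, (D.reqRate i / D.n) * z.aFD i * D.reqProb i j = D.mu i j * z.f i j
  little_crowd : ∀ β i j,
    D.reqRate i * z.aCrowd β i j ≤ D.crowdRate β i * D.crowdProb β i j
  flow_relocate : ∀ i j, i ≠ j → D.mu i j * z.e i j ≤ ∑ k, D.mu k i * z.f k i
  flow_lower : ∀ i,
    ∑ k with k ≠ i, D.mu k i * z.e k i ≤ (D.reqRate i / D.n) * z.aFD i
  flow_upper : ∀ i,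
    (D.reqRate i / D.n) * z.aFD i
      ≤ ∑ k with k ≠ i, D.mu k i * z.e k i + ∑ k, D.mu k i * z.f k i
  flow_balance : ∀ i,
    (D.reqRate i / D.n) * z.aFD i + ∑ j with j ≠ i, D.mu i j * z.e i j
      = ∑ k with k ≠ i, D.mu k i * z.e k i + ∑ k, D.mu k i * z.f k i
  availability : ∀ i,
    z.aFD i + ∑ j, (z.aCrowd .gigWorker i j + z.aCrowd .occasional i j + z.aLost i j) = 1
  aFD_mem : ∀ i, 0 ≤ z.aFD i ∧ z.aFD i ≤ 1
  aCrowd_mem : ∀ β i j, 0 ≤ z.aCrowd β i j ∧ z.aCrowd β i j ≤ D.reqProb i j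
  aLost_mem : ∀ i j, 0 ≤ z.aLost i j ∧ z.aLost i j ≤ 1
  e_mem : ∀ i j, 0 ≤ z.e i j ∧ z.e i j ≤ 1
  f_mem : ∀ i j, 0 ≤ z.f i j ∧ z.f i j ≤ 1
  total : ∑ i, ∑ j, (z.e i j + z.f i j) = 1

/-- The objective of the fluid linear program. -/
noncomputable def Network.objective (D : Network M) (z : FluidVars M) : ℝ :=
  ∑ i, ∑ j,
    (D.reqRate i *
        ((D.costCrowd .gigWorker i j * z.aCrowd .gigWorker i j
            + D.costCrowd .occasional i j * z.aCrowd .occasional i j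
            + D.costLost i j * z.aLost i j)
          + D.costFD i j * D.reqProb i j * z.aFD i)
      + (1 - if i = j then 1 else 0) * D.costFD i j * D.n * z.e i j)

/-- `v` is the optimal value of the fluid linear program: it is attained and minimal. -/
def Network.IsFluidOptimum (D : Network M) (v : ℝ) : Prop :=
  IsLeast {c : ℝ | ∃ z, D.Feasible z ∧ D.objective z = c} v

end LP

/-! ### The closed queueing network -/

/-- A state of the network: `E i i` FDs idle at `i`, `E i j` FDs relocate (empty) from `i` to `j`
for `i ≠ j`, `F i j` FDs serve a request from `i` to `j`, and `pool β i j` crowdsourced drivers of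
kind `β` wait at `i` for a request to `j`. -/
@[ext] structure State (M : Type*) where
  E : M → M → ℕ
  F : M → M → ℕ
  pool : Crowd → M → M → ℕ

section Chain

variable {M : Type*} [Fintype M] [DecidableEq M]

/-- Total number of FDs in a state. -/
def State.fleet (x : State M) : ℕ := ∑ i, ∑ j, (x.E i j + x.F i j)

/-- Increase entry `(i, j)` by one. -/
def incr (g : M → M → ℕ) (i j : M) : M → M → ℕ :=
  Function.update g i (Function.update (g i) j (g i j + 1))

/-- Decrease entry `(i, j)` by one (only used for transitions where it is positive). -/
def decr (g : M → M → ℕ) (i j : M) : M → M → ℕ :=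
  Function.update g i (Function.update (g i) j (g i j - 1))

/-- An idle FD at `i` takes a request to `j`. -/
def State.startService (x : State M) (i j : M) : State M :=
  { x with E := decr x.E i i, F := incr x.F i j }

/-- An FD that served a request from `k` to `i` finishes and joins `E i j`: it idles at `i` if
`j = i`, and starts to relocate from `i` to `j` otherwise. -/
def State.endService (x : State M) (k i j : M) : State M :=
  { x with E := incr x.E i j, F := decr x.F k i }

/-- An FD relocating from `i` to `j` arrives and idles at `j`. -/
def State.endRelocation (x : State M) (i j : M) : State M :=
  { x with E := incr (decr x.E i j) j j }

/-- A crowdsourced driver joins a pool. -/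
def State.crowdJoin (x : State M) (β : Crowd) (i j : M) : State M :=
  { x with pool := Function.update x.pool β (incr (x.pool β) i j) }

/-- A crowdsourced driver leaves a pool, with or without a request. -/
def State.crowdExit (x : State M) (β : Crowd) (i j : M) : State M :=
  { x with pool := Function.update x.pool β (decr (x.pool β) i j) }

/-- A (randomized, state dependent) operating policy.
* `matchFD x i`: probability that a request arriving at `i` in state `x` is given to an idle FD.
  It does not depend on the destination of the request.  The choice `1` if `x.E i i > 0`, and
  `0` otherwise, makes `E i i` a single server queue with service rate `reqRate i`.
* `matchCrowd x β i j`: probability that a request from `i` to `j` arriving in state `x` is given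
  to a waiting crowdsourced driver of kind `β`.  With the remaining probability it is lost.
* `Q x i j`: probability that an FD that finishes a service at `i` in state `x` is sent to `j`
  (`j = i` means that it idles at `i`). -/
structure Policy (M : Type*) [Fintype M] where
  matchFD : State M → M → ℝ
  matchFD_nonneg : ∀ x i, 0 ≤ matchFD x i
  matchFD_idle : ∀ x i, x.E i i = 0 → matchFD x i = 0
  matchCrowd : State M → Crowd → M → M → ℝ
  matchCrowd_nonneg : ∀ x β i j, 0 ≤ matchCrowd x β i j
  matchCrowd_pool : ∀ x β i j, x.pool β i j = 0 → matchCrowd x β i j = 0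
  match_le_one : ∀ x i j, matchFD x i + ∑ β, matchCrowd x β i j ≤ 1
  Q : State M → M → M → ℝ
  Q_nonneg : ∀ x i j, 0 ≤ Q x i j
  Q_sum : ∀ x i, ∑ j, Q x i j = 1

/-- How crowdsourced drivers wait: `join x β i j` is the probability that a driver arriving in
state `x` waits for a request rather than leaving at once, and `leave x β i j` is the rate at which
waiting drivers give up.  Finite waiting room and exponential patience are special cases. -/
structure CrowdBehaviour (M : Type*) where
  join : State M → Crowd → M → M → ℝ
  join_nonneg : ∀ x β i j, 0 ≤ join x β i j
  join_le_one : ∀ x β i j, join x β i j ≤ 1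
  leave : State M → Crowd → M → M → ℝ
  leave_nonneg : ∀ x β i j, 0 ≤ leave x β i j
  leave_pool : ∀ x β i j, x.pool β i j = 0 → leave x β i j = 0

/-- The generator of the continuous-time Markov chain of the network: the sum, over all
transitions, of the rate of the transition times the change of `g`. -/
noncomputable def Network.generator (D : Network M) (p : Policy M) (b : CrowdBehaviour M)
    (g : State M → ℝ) (x : State M) : ℝ :=
  (∑ i, ∑ j, D.reqRate i * D.reqProb i j * p.matchFD x i * (g (x.startService i j) - g x))
  + (∑ β, ∑ i, ∑ j, D.reqRate i * D.reqProb i j * p.matchCrowd x β i j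
      * (g (x.crowdExit β i j) - g x))
  + (∑ k, ∑ i, ∑ j, D.mu k i * x.F k i * p.Q x i j * (g (x.endService k i j) - g x))
  + (∑ i, ∑ j with j ≠ i, D.mu i j * x.E i j * (g (x.endRelocation i j) - g x))
  + (∑ β, ∑ i, ∑ j, D.crowdRate β i * D.crowdProb β i j * b.join x β i j
      * (g (x.crowdJoin β i j) - g x))
  + (∑ β, ∑ i, ∑ j, b.leave x β i j * (g (x.crowdExit β i j) - g x))

/-- `π` is a steady state (stationary distribution) of the closed network with `D.n` FDs: a
probability mass function on the states with `D.n` FDs that satisfies the global balance equations.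
These are written by duality with finitely supported functions, so all the sums are finite;
the indicator of `{y}` gives the balance equation at `y`. -/
structure Network.IsSteadyState (D : Network M) (p : Policy M) (b : CrowdBehaviour M)
    (π : State M → ℝ) : Prop where
  nonneg : ∀ x, 0 ≤ π x
  hasSum_one : HasSum π 1
  closed : ∀ x, π x ≠ 0 → x.fleet = D.n
  balance : ∀ g : State M → ℝ, g.support.Finite → ∑' x, π x * D.generator p b g x = 0

/-- Expected operational cost per unit of time in state `x`: the costs of the arriving requests,
by the way they are matched, and the cost of the FDs that are relocating. -/
noncomputable def Network.costRate (D : Network M) (p : Policy M) (x : State M) : ℝ :=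
  ∑ i, ∑ j,
    (D.reqRate i * D.reqProb i j *
        (D.costFD i j * p.matchFD x i + ∑ β, D.costCrowd β i j * p.matchCrowd x β i j
          + D.costLost i j * (1 - p.matchFD x i - ∑ β, p.matchCrowd x β i j))
      + if i = j then 0 else D.costFD i j * x.E i j)

/-- Operational cost (per unit of time) in the steady state `π`.  The cost rate is bounded on the
states with `D.n` FDs, so this series converges absolutely. -/
noncomputable def Network.operationalCost (D : Network M) (p : Policy M) (π : State M → ℝ) : ℝ :=
  ∑' x, π x * D.costRate p x

end Chain

end DeliveryNetwork

open DeliveryNetwork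

/-!
The point of the linear program that a steady state `π` defines has as coordinates the mean
fractions of the fleet in each activity, the mean matching probabilities `matchFD`, and the means
of `matchCrowd` and of the probability of a loss, weighted with the destination probabilities.
Since the cost rate is affine in these quantities, the objective at this point equals the
operational cost (`Network.IsSteadyState.objective_meanVars`).  It remains to see that the point is
feasible (`Network.IsSteadyState.feasible_meanVars`) and that the minimum is attained.  The latter
is compactness: the feasible set is closed in a unit cube, and it is not empty because the whole
fleet may idle at one location while all requests are lost.  The asymptotic statement is the bound
applied to each member of the sequence.

The flow constraints are rate conservation laws: the drift `generator θ` of a counting function `θ`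
has mean zero.  The functions `F i j`, `E i j`, `E i i` and `∑ j, E i j` give Little's law for
services, the bound on relocations, the lower bound for the services started at `i`, and the flow
balance at `i`.

The balance equations hold for finitely supported test functions only, whereas the pools of
crowdsourced drivers are unbounded and may be left at unbounded rates, so that the chain need not be
regular.  `Network.IsSteadyState.mean_nonneg_of_generator_le` deals with this: let `u K` be the
indicator function of the states with pools of size at most `K`.  A transition that leaves this set
is an arrival, which has a bounded rate and starts in the outermost layer, so the expected total
variation of `u K` along transitions is at most its drift, whose mean is zero, plus a constant times
the probability of that layer, which tends to zero.  Hence the balance equation for `u K * θ` passes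
to the limit for every `θ` that is bounded on the states with a bounded fleet.  The number of waiting
drivers of one kind on one route is not bounded, and its mean may be infinite; its truncation gives
the constraint on the matches of crowdsourced drivers
(`Network.IsSteadyState.mean_matchCrowd_le`).
-/

namespace DeliveryNetwork

open Topology

-- Most lemmas are about the fixed data of a section, which they need not use in full.
set_option linter.unusedSectionVars false

/-! ### Attainment of the optimum of the linear program -/

section LP

variable {M : Type*} [Fintype M] [DecidableEq M]

lemma Network.reqProb_le_one (D : Network M) (i j : M) : D.reqProb i j ≤ 1 := by
  rw [← D.reqProb_sum i]
  exact Finset.single_le_sum (fun k _ => D.reqProb_nonneg i k) (Finset.mem_univ j)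

/-- All full-time drivers idle at the location `i₀` and every request is lost. -/
lemma Network.feasible_idle (D : Network M) (i₀ : M) :
    D.Feasible
      { e := fun i j => if i = i₀ ∧ j = i₀ then 1 else 0
        f := 0, aFD := 0, aCrowd := 0, aLost := D.reqProb } := by
  have h0 : ∀ i j : M, i ≠ j → (if i = i₀ ∧ j = i₀ then (1 : ℝ) else 0) = 0 := by
    intro i j hij
    rw [if_neg]
    rintro ⟨rfl, rfl⟩
    exact hij rfl
  have hin : ∀ i : M,
      ∑ k with k ≠ i, D.mu k i * (if k = i₀ ∧ i = i₀ then (1 : ℝ) else 0) = 0 := by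
    intro i
    refine Finset.sum_eq_zero fun k hk => ?_
    rw [h0 k i (Finset.mem_filter.mp hk).2, mul_zero]
  have hout : ∀ i : M,
      ∑ j with j ≠ i, D.mu i j * (if i = i₀ ∧ j = i₀ then (1 : ℝ) else 0) = 0 := by
    intro i
    refine Finset.sum_eq_zero fun k hk => ?_
    rw [h0 i k (Finset.mem_filter.mp hk).2.symm, mul_zero]
  constructor
  · simp
  · intro β i j
    simpa using mul_nonneg (D.crowdRate_nonneg β i) (D.crowdProb_nonneg β i j)
  · intro i j hij
    simp [h0 i j hij]
  · intro i
    simp only [hin]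
    simp
  · intro i
    simp only [hin]
    simp
  · intro i
    simp only [hin, hout]
    simp
  · intro i
    simp [D.reqProb_sum]
  · simp
  · intro β i j
    simpa using D.reqProb_nonneg i j
  · exact fun i j => ⟨D.reqProb_nonneg i j, D.reqProb_le_one i j⟩
  · intro i j
    dsimp only
    split_ifs <;> simp
  · simp
  · simp [ite_and]

/-- The variables of the linear program as a point of a finite-dimensional space. -/
abbrev FluidSpace (M : Type*) : Type _ :=
  (M → M → ℝ) × (M → M → ℝ) × (M → ℝ) × (Crowd → M → M → ℝ) × (M → M → ℝ)

/-- The variables of the linear program with the given coordinates. -/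
def FluidSpace.toVars (y : FluidSpace M) : FluidVars M :=
  ⟨y.1, y.2.1, y.2.2.1, y.2.2.2.1, y.2.2.2.2⟩


lemma Network.isClosed_feasible (D : Network M) :
    IsClosed {y : FluidSpace M | D.Feasible y.toVars} := by
  have key : {y : FluidSpace M | D.Feasible y.toVars} =
      {y | (∀ i j, (D.reqRate i / D.n) * y.toVars.aFD i * D.reqProb i j
              = D.mu i j * y.toVars.f i j) ∧
        (∀ β i j, D.reqRate i * y.toVars.aCrowd β i j ≤ D.crowdRate β i * D.crowdProb β i j) ∧
        (∀ i j, i ≠ j → D.mu i j * y.toVars.e i j ≤ ∑ k, D.mu k i * y.toVars.f k i) ∧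
        (∀ i, ∑ k with k ≠ i, D.mu k i * y.toVars.e k i
              ≤ (D.reqRate i / D.n) * y.toVars.aFD i) ∧
        (∀ i, (D.reqRate i / D.n) * y.toVars.aFD i
              ≤ ∑ k with k ≠ i, D.mu k i * y.toVars.e k i + ∑ k, D.mu k i * y.toVars.f k i) ∧
        (∀ i, (D.reqRate i / D.n) * y.toVars.aFD i + ∑ j with j ≠ i, D.mu i j * y.toVars.e i j
              = ∑ k with k ≠ i, D.mu k i * y.toVars.e k i + ∑ k, D.mu k i * y.toVars.f k i) ∧
        (∀ i, y.toVars.aFD i + ∑ j, (y.toVars.aCrowd .gigWorker i j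
              + y.toVars.aCrowd .occasional i j + y.toVars.aLost i j) = 1) ∧
        (∀ i, 0 ≤ y.toVars.aFD i ∧ y.toVars.aFD i ≤ 1) ∧
        (∀ β i j, 0 ≤ y.toVars.aCrowd β i j ∧ y.toVars.aCrowd β i j ≤ D.reqProb i j) ∧
        (∀ i j, 0 ≤ y.toVars.aLost i j ∧ y.toVars.aLost i j ≤ 1) ∧
        (∀ i j, 0 ≤ y.toVars.e i j ∧ y.toVars.e i j ≤ 1) ∧
        (∀ i j, 0 ≤ y.toVars.f i j ∧ y.toVars.f i j ≤ 1) ∧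
        ∑ i, ∑ j, (y.toVars.e i j + y.toVars.f i j) = 1} := by
    ext y
    constructor
    · rintro ⟨h1, h2, h3, h4, h5, h6, h7, h8, h9, h10, h11, h12, h13⟩
      exact ⟨h1, h2, h3, h4, h5, h6, h7, h8, h9, h10, h11, h12, h13⟩
    · rintro ⟨h1, h2, h3, h4, h5, h6, h7, h8, h9, h10, h11, h12, h13⟩
      exact ⟨h1, h2, h3, h4, h5, h6, h7, h8, h9, h10, h11, h12, h13⟩
  rw [key]
  simp only [FluidSpace.toVars, Set.ofPred_and, Set.ofPred_forall]
  repeat' first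
    | apply IsClosed.inter
    | (apply isClosed_iInter; intro)
    | exact isClosed_le (by fun_prop) (by fun_prop)
    | exact isClosed_eq (by fun_prop) (by fun_prop)

lemma Network.isCompact_feasible (D : Network M) :
    IsCompact {y : FluidSpace M | D.Feasible y.toVars} := by
  refine (isCompact_Icc (a := (0 : FluidSpace M)) (b := 1)).of_isClosed_subset
    D.isClosed_feasible fun y hy => ?_
  exact ⟨⟨fun i j => (hy.e_mem i j).1, fun i j => (hy.f_mem i j).1, fun i => (hy.aFD_mem i).1,
      fun β i j => (hy.aCrowd_mem β i j).1, fun i j => (hy.aLost_mem i j).1⟩,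
    ⟨fun i j => (hy.e_mem i j).2, fun i j => (hy.f_mem i j).2, fun i => (hy.aFD_mem i).2,
      fun β i j => (hy.aCrowd_mem β i j).2.trans (D.reqProb_le_one i j),
      fun i j => (hy.aLost_mem i j).2⟩⟩

lemma Network.exists_isFluidOptimum [Nonempty M] (D : Network M) :
    ∃ v, D.IsFluidOptimum v := by
  obtain ⟨i₀⟩ := ‹Nonempty M›
  have hcont : Continuous fun y : FluidSpace M => D.objective y.toVars := by
    simp only [Network.objective, FluidSpace.toVars]
    fun_prop
  obtain ⟨y, hy, hmin⟩ := D.isCompact_feasible.exists_isMinOn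
    ⟨(fun i j => if i = i₀ ∧ j = i₀ then 1 else 0, 0, 0, 0, D.reqProb), D.feasible_idle i₀⟩
    hcont.continuousOn
  refine ⟨D.objective y.toVars, ⟨y.toVars, hy, rfl⟩, ?_⟩
  rintro c ⟨z, hz, rfl⟩
  exact isMinOn_iff.mp hmin (z.e, z.f, z.aFD, z.aCrowd, z.aLost) hz

end LP

section Chain

variable {M : Type*} [Fintype M] [DecidableEq M]

/-! ### The generator as a sum over transitions -/

/-- The transitions of the network: the start of a service, the end of a service, the end of a
relocation, the arrival of a waiting crowdsourced driver, and the departure of one.  In the last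
case, departures with and without a request are merged. -/
abbrev Jump (M : Type*) : Type _ :=
  (M × M) ⊕ (M × M × M) ⊕ (M × M) ⊕ (Crowd × M × M) ⊕ (Crowd × M × M)

/-- The state reached by a transition. -/
def Jump.target : Jump M → State M → State M
  | .inl (i, j), x => x.startService i j
  | .inr (.inl (k, i, j)), x => x.endService k i j
  | .inr (.inr (.inl (i, j))), x => x.endRelocation i j
  | .inr (.inr (.inr (.inl (β, i, j)))), x => x.crowdJoin β i j
  | .inr (.inr (.inr (.inr (β, i, j)))), x => x.crowdExit β i j

/-- The rate of a transition.  Relocations from a location to itself do not exist, so they get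
the rate zero. -/
def Network.jumpRate (D : Network M) (p : Policy M) (b : CrowdBehaviour M) :
    Jump M → State M → ℝ
  | .inl (i, j), x => D.reqRate i * D.reqProb i j * p.matchFD x i
  | .inr (.inl (k, i, j)), x => D.mu k i * x.F k i * p.Q x i j
  | .inr (.inr (.inl (i, j))), x => if j ≠ i then D.mu i j * x.E i j else 0
  | .inr (.inr (.inr (.inl (β, i, j)))), x =>
      D.crowdRate β i * D.crowdProb β i j * b.join x β i j
  | .inr (.inr (.inr (.inr (β, i, j)))), x =>
      D.reqRate i * D.reqProb i j * p.matchCrowd x β i j + b.leave x β i j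

/-- A bound, uniform in the state, for the rates at which crowdsourced drivers arrive; zero for
the other transitions. -/
def Network.joinBound (D : Network M) : Jump M → ℝ
  | .inr (.inr (.inr (.inl (β, i, j)))) => D.crowdRate β i * D.crowdProb β i j
  | _ => 0

lemma Network.generator_eq (D : Network M) (p : Policy M) (b : CrowdBehaviour M)
    (g : State M → ℝ) (x : State M) :
    D.generator p b g x = ∑ t, D.jumpRate p b t x * (g (t.target x) - g x) := by
  simp only [Network.generator, Fintype.sum_sum_type, Fintype.sum_prod_type, Network.jumpRate,
    Jump.target, add_mul, Finset.sum_add_distrib, ite_mul, zero_mul, Finset.sum_filter]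
  ring

lemma Network.jumpRate_nonneg (D : Network M) (p : Policy M) (b : CrowdBehaviour M)
    (t : Jump M) (x : State M) : 0 ≤ D.jumpRate p b t x := by
  rcases t with ⟨i, j⟩ | ⟨k, i, j⟩ | ⟨i, j⟩ | ⟨β, i, j⟩ | ⟨β, i, j⟩
  · exact mul_nonneg (mul_nonneg (D.reqRate_nonneg i) (D.reqProb_nonneg i j))
      (p.matchFD_nonneg x i)
  · exact mul_nonneg (mul_nonneg (D.mu_pos k i).le (Nat.cast_nonneg _)) (p.Q_nonneg x i j)
  · simp only [Network.jumpRate]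
    split_ifs
    · exact mul_nonneg (D.mu_pos i j).le (Nat.cast_nonneg _)
    · exact le_rfl
  · exact mul_nonneg (mul_nonneg (D.crowdRate_nonneg β i) (D.crowdProb_nonneg β i j))
      (b.join_nonneg x β i j)
  · exact add_nonneg (mul_nonneg (mul_nonneg (D.reqRate_nonneg i) (D.reqProb_nonneg i j))
      (p.matchCrowd_nonneg x β i j)) (b.leave_nonneg x β i j)

lemma Network.generator_neg (D : Network M) (p : Policy M) (b : CrowdBehaviour M)
    (g : State M → ℝ) (x : State M) :
    D.generator p b (fun y => -g y) x = -D.generator p b g x := by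
  simp only [D.generator_eq, ← Finset.sum_neg_distrib]
  exact Finset.sum_congr rfl fun t _ => by ring

lemma Network.generator_sum (D : Network M) (p : Policy M) (b : CrowdBehaviour M)
    {ι : Type*} (s : Finset ι) (g : ι → State M → ℝ) (x : State M) :
    D.generator p b (fun y => ∑ a ∈ s, g a y) x = ∑ a ∈ s, D.generator p b (g a) x := by
  simp only [D.generator_eq, ← Finset.sum_sub_distrib, Finset.mul_sum]
  exact Finset.sum_comm

/-! ### Elementary bounds on states and transitions -/

lemma incr_apply (g : M → M → ℕ) (i j a b : M) :
    incr g i j a b = g a b + if a = i ∧ b = j then 1 else 0 := by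
  by_cases ha : a = i
  · subst ha
    by_cases hb : b = j
    · subst hb
      simp [incr]
    · simp [incr, hb]
  · simp [incr, ha]

lemma decr_apply (g : M → M → ℕ) (i j a b : M) :
    decr g i j a b = g a b - if a = i ∧ b = j then 1 else 0 := by
  by_cases ha : a = i
  · subst ha
    by_cases hb : b = j
    · subst hb
      simp [decr]
    · simp [decr, hb]
  · simp [decr, ha]

lemma State.crowdJoin_pool (x : State M) (β γ : Crowd) (i j a b : M) :
    (x.crowdJoin β i j).pool γ a b
      = x.pool γ a b + if γ = β ∧ a = i ∧ b = j then 1 else 0 := by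
  by_cases h : γ = β
  · subst h
    simp [State.crowdJoin, incr_apply]
  · simp [State.crowdJoin, h]

lemma State.crowdExit_pool (x : State M) (β γ : Crowd) (i j a b : M) :
    (x.crowdExit β i j).pool γ a b
      = x.pool γ a b - if γ = β ∧ a = i ∧ b = j then 1 else 0 := by
  by_cases h : γ = β
  · subst h
    simp [State.crowdExit, decr_apply]
  · simp [State.crowdExit, h]

lemma State.E_le_fleet (x : State M) (i j : M) : x.E i j ≤ x.fleet :=
  calc x.E i j ≤ x.E i j + x.F i j := Nat.le_add_right _ _
    _ ≤ ∑ j, (x.E i j + x.F i j) :=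
      Finset.single_le_sum (f := fun j => x.E i j + x.F i j) (fun _ _ => Nat.zero_le _)
        (Finset.mem_univ j)
    _ ≤ x.fleet :=
      Finset.single_le_sum (f := fun i => ∑ j, (x.E i j + x.F i j)) (fun _ _ => Nat.zero_le _)
        (Finset.mem_univ i)

lemma State.F_le_fleet (x : State M) (i j : M) : x.F i j ≤ x.fleet :=
  calc x.F i j ≤ x.E i j + x.F i j := Nat.le_add_left _ _
    _ ≤ ∑ j, (x.E i j + x.F i j) :=
      Finset.single_le_sum (f := fun j => x.E i j + x.F i j) (fun _ _ => Nat.zero_le _)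
        (Finset.mem_univ j)
    _ ≤ x.fleet :=
      Finset.single_le_sum (f := fun i => ∑ j, (x.E i j + x.F i j)) (fun _ _ => Nat.zero_le _)
        (Finset.mem_univ i)

/-- All the numbers of full-time drivers in the state are at most `N`. -/
def State.FleetBdd (N : ℕ) (x : State M) : Prop := ∀ i j, x.E i j ≤ N ∧ x.F i j ≤ N

/-- All the numbers of waiting crowdsourced drivers in the state are at most `K`. -/
def State.PoolBdd (K : ℕ) (x : State M) : Prop := ∀ β i j, x.pool β i j ≤ K

lemma State.fleetBdd_fleet (x : State M) : x.FleetBdd x.fleet :=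
  fun i j => ⟨x.E_le_fleet i j, x.F_le_fleet i j⟩

lemma Jump.fleetBdd_target {N : ℕ} {x : State M} (hx : x.FleetBdd N) (t : Jump M) :
    (t.target x).FleetBdd (N + 1) := by
  intro a c
  obtain ⟨hE, hF⟩ := hx a c
  rcases t with ⟨i, j⟩ | ⟨k, i, j⟩ | ⟨i, j⟩ | ⟨β, i, j⟩ | ⟨β, i, j⟩ <;>
    simp only [Jump.target, State.startService, State.endService, State.endRelocation,
      State.crowdJoin, State.crowdExit, incr_apply, decr_apply] <;>
    constructor <;> (try split_ifs) <;> omega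

lemma Jump.poolBdd_target {K : ℕ} {x : State M} (hx : x.PoolBdd K) (t : Jump M) :
    (t.target x).PoolBdd (K + 1) := by
  intro γ a c
  have h := hx γ a c
  rcases t with ⟨i, j⟩ | ⟨k, i, j⟩ | ⟨i, j⟩ | ⟨β, i, j⟩ | ⟨β, i, j⟩ <;>
    simp only [Jump.target, State.startService, State.endService, State.endRelocation,
      State.crowdJoin_pool, State.crowdExit_pool] <;> (try split_ifs) <;> omega

lemma Jump.poolBdd_of_target {K : ℕ} {x : State M} (t : Jump M)
    (hx : (t.target x).PoolBdd K) : x.PoolBdd (K + 1) := by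
  intro γ a c
  have h := hx γ a c
  rcases t with ⟨i, j⟩ | ⟨k, i, j⟩ | ⟨i, j⟩ | ⟨β, i, j⟩ | ⟨β, i, j⟩ <;>
    simp only [Jump.target, State.startService, State.endService, State.endRelocation,
      State.crowdJoin_pool, State.crowdExit_pool] at h <;> (try split_ifs at h) <;> omega

/-- The states in which every count of full-time drivers is at most `N` and every count of waiting
crowdsourced drivers is at most `K`. -/
def box (M : Type*) (N K : ℕ) : Set (State M) := {x | x.FleetBdd N ∧ x.PoolBdd K}

lemma finite_box (N K : ℕ) : (box M N K).Finite := by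
  classical
  refine ((((Set.finite_Icc (0 : M → M → ℕ) (fun _ _ => N)).prod
    (Set.finite_Icc (0 : M → M → ℕ) (fun _ _ => N))).prod
    (Set.finite_Icc (0 : Crowd → M → M → ℕ) (fun _ _ _ => K))).image
    fun y => State.mk y.1.1 y.1.2 y.2).subset ?_
  rintro x ⟨hN, hK⟩
  exact ⟨((x.E, x.F), x.pool), ⟨⟨⟨fun _ _ => Nat.zero_le _, fun i j => (hN i j).1⟩,
    ⟨fun _ _ => Nat.zero_le _, fun i j => (hN i j).2⟩⟩,
    ⟨fun _ _ _ => Nat.zero_le _, fun β i j => hK β i j⟩⟩, rfl⟩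

/-! ### Stationary means -/

/-- The function `r` of the state has expectation `s` under `π`. -/
def HasMean (π : State M → ℝ) (r : State M → ℝ) (s : ℝ) : Prop := HasSum (fun x => π x * r x) s

variable {π : State M → ℝ} {r r' : State M → ℝ} {s s' : ℝ}

lemma HasMean.add (h : HasMean π r s) (h' : HasMean π r' s') :
    HasMean π (fun x => r x + r' x) (s + s') := by
  simpa only [HasMean, mul_add] using HasSum.add h h'

lemma HasMean.sub (h : HasMean π r s) (h' : HasMean π r' s') :
    HasMean π (fun x => r x - r' x) (s - s') := by
  simpa only [HasMean, mul_sub] using HasSum.sub h h'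

lemma HasMean.const_mul (c : ℝ) (h : HasMean π r s) :
    HasMean π (fun x => c * r x) (c * s) := by
  simpa only [HasMean, mul_left_comm] using HasSum.mul_left c h

lemma HasMean.sum {ι : Type*} {t : Finset ι} {r : ι → State M → ℝ} {s : ι → ℝ}
    (h : ∀ a ∈ t, HasMean π (r a) (s a)) :
    HasMean π (fun x => ∑ a ∈ t, r a x) (∑ a ∈ t, s a) := by
  simpa only [HasMean, Finset.mul_sum] using hasSum_sum h

variable {D : Network M} {p : Policy M} {b : CrowdBehaviour M}

lemma Network.IsSteadyState.hasMean_const (hπ : D.IsSteadyState p b π) (c : ℝ) :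
    HasMean π (fun _ => c) c := by
  simpa only [HasMean, one_mul] using hπ.hasSum_one.mul_right c

lemma Network.IsSteadyState.hasMean_tsum (hπ : D.IsSteadyState p b π) (R : ℝ)
    (hr : ∀ x, x.fleet = D.n → |r x| ≤ R) : HasMean π r (∑' x, π x * r x) := by
  refine Summable.hasSum (Summable.of_norm_bounded (hπ.hasSum_one.summable.mul_right R)
    fun x => ?_)
  rw [Real.norm_eq_abs, abs_mul, abs_of_nonneg (hπ.nonneg x)]
  by_cases hx : π x = 0
  · simp [hx]
  · exact mul_le_mul_of_nonneg_left (hr x (hπ.closed x hx)) (hπ.nonneg x)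

lemma Network.IsSteadyState.mean_le_mean (hπ : D.IsSteadyState p b π)
    (h : HasMean π r s) (h' : HasMean π r' s') (hle : ∀ x, x.fleet = D.n → r x ≤ r' x) :
    s ≤ s' := by
  refine hasSum_le (fun x => ?_) h h'
  by_cases hx : π x = 0
  · simp [hx]
  · exact mul_le_mul_of_nonneg_left (hle x (hπ.closed x hx)) (hπ.nonneg x)

/-! ### Drift criterion for stationary means -/

/-- The balance equation for a test function supported in a box.  The generator of such a function
vanishes outside a larger box on the states that `π` charges, so the series in the balance equation
is a finite sum. -/
lemma Network.IsSteadyState.hasMean_generator (hπ : D.IsSteadyState p b π) {K : ℕ}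
    {g : State M → ℝ} (hg : ∀ x, x ∉ box M (D.n + 1) K → g x = 0) :
    HasMean π (D.generator p b g) 0 := by
  have hsupp : g.support.Finite := (finite_box (D.n + 1) K).subset fun x hx => by
    by_contra h
    exact hx (hg x h)
  have hzero : ∀ x ∉ (finite_box (M := M) (D.n + 1) (K + 1)).toFinset,
      π x * D.generator p b g x = 0 := by
    intro x hx
    by_cases hx0 : π x = 0
    · simp [hx0]
    have hW : x.FleetBdd (D.n + 1) := fun i j => by
      have := x.fleetBdd_fleet i j
      rw [hπ.closed x hx0] at this
      omega
    have hP : ¬ x.PoolBdd (K + 1) := fun h => hx (by simpa using ⟨hW, h⟩)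
    have h1 : g x = 0 := hg x fun h => hP fun β i j => (h.2 β i j).trans (Nat.le_succ K)
    have h2 : ∀ t : Jump M, g (t.target x) = 0 :=
      fun t => hg _ fun h => hP (t.poolBdd_of_target h.2)
    simp [D.generator_eq, h1, h2]
  have hs : Summable fun x => π x * D.generator p b g x :=
    (hasSum_sum_of_ne_finset_zero hzero).summable
  have := hs.hasSum
  rwa [hπ.balance g hsupp] at this

/-- The indicator function of the box with pools of size at most `K`. -/
noncomputable def cutoff (M : Type*) (N K : ℕ) : State M → ℝ := (box M N K).indicator 1

lemma cutoff_eq_one {N K : ℕ} {x : State M} (hN : x.FleetBdd N) (hK : x.PoolBdd K) :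
    cutoff M N K x = 1 :=
  Set.indicator_of_mem (show x ∈ box M N K from ⟨hN, hK⟩) _

lemma cutoff_eq_zero {N K : ℕ} {x : State M} (hx : x ∉ box M N K) : cutoff M N K x = 0 :=
  Set.indicator_of_notMem hx _

lemma cutoff_nonneg (N K : ℕ) (x : State M) : 0 ≤ cutoff M N K x :=
  Set.indicator_nonneg (fun _ _ => zero_le_one) x

lemma cutoff_le_one (N K : ℕ) (x : State M) : cutoff M N K x ≤ 1 :=
  Set.indicator_le_self' (f := (1 : State M → ℝ)) (fun _ _ => zero_le_one) x

lemma tendsto_cutoff {N : ℕ} {x : State M} (hx : x.FleetBdd N) :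
    Tendsto (fun K => cutoff M N K x) atTop (𝓝 1) := by
  refine tendsto_const_nhds.congr' ?_
  filter_upwards [eventually_ge_atTop (∑ β, ∑ i, ∑ j, x.pool β i j)] with K hK
  refine (cutoff_eq_one hx fun β i j => le_trans ?_ hK).symm
  calc x.pool β i j ≤ ∑ j, x.pool β i j :=
        Finset.single_le_sum (f := fun j => x.pool β i j) (fun _ _ => Nat.zero_le _)
          (Finset.mem_univ j)
    _ ≤ ∑ i, ∑ j, x.pool β i j :=
        Finset.single_le_sum (f := fun i => ∑ j, x.pool β i j) (fun _ _ => Nat.zero_le _)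
          (Finset.mem_univ i)
    _ ≤ ∑ β, ∑ i, ∑ j, x.pool β i j :=
        Finset.single_le_sum (f := fun β => ∑ i, ∑ j, x.pool β i j) (fun _ _ => Nat.zero_le _)
          (Finset.mem_univ β)

lemma Network.joinBound_nonneg (D : Network M) (t : Jump M) : 0 ≤ D.joinBound t := by
  rcases t with ⟨i, j⟩ | ⟨k, i, j⟩ | ⟨i, j⟩ | ⟨β, i, j⟩ | ⟨β, i, j⟩ <;>
    simp only [Network.joinBound, le_refl]
  exact mul_nonneg (D.crowdRate_nonneg β i) (D.crowdProb_nonneg β i j)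

/-- Only arrivals of crowdsourced drivers leave a box, at a bounded rate and from its outermost
layer.  The rates at which boxes are entered need not be bounded, so they are controlled by the
change of the cutoff itself, whose stationary mean vanishes. -/
lemma Network.jumpRate_mul_abs_cutoff_le {x : State M} (hx : x.fleet = D.n) (K : ℕ)
    (t : Jump M) :
    D.jumpRate p b t x
        * |cutoff M (D.n + 1) (K + 1) (t.target x) - cutoff M (D.n + 1) (K + 1) x|
      ≤ D.jumpRate p b t x
          * (cutoff M (D.n + 1) (K + 1) (t.target x) - cutoff M (D.n + 1) (K + 1) x)
        + 2 * D.joinBound t * (cutoff M (D.n + 1) (K + 1) x - cutoff M (D.n + 1) K x) := by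
  have hr := D.jumpRate_nonneg p b t x
  have hj := D.joinBound_nonneg t
  have hW0 : x.FleetBdd D.n := hx ▸ x.fleetBdd_fleet
  have hW : x.FleetBdd (D.n + 1) := fun i j =>
    ⟨(hW0 i j).1.trans (Nat.le_succ _), (hW0 i j).2.trans (Nat.le_succ _)⟩
  have hWt : (t.target x).FleetBdd (D.n + 1) := t.fleetBdd_target hW0
  have hmono : cutoff M (D.n + 1) K x ≤ cutoff M (D.n + 1) (K + 1) x := by
    by_cases h : x ∈ box M (D.n + 1) K
    · rw [cutoff_eq_one hW h.2, cutoff_eq_one hW fun β i j => (h.2 β i j).trans (Nat.le_succ K)]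
    · rw [cutoff_eq_zero h]
      exact cutoff_nonneg _ _ _
  have hlayer : 0 ≤ 2 * D.joinBound t
      * (cutoff M (D.n + 1) (K + 1) x - cutoff M (D.n + 1) K x) :=
    mul_nonneg (by linarith) (by linarith)
  by_cases hin : x.PoolBdd (K + 1)
  · by_cases hout : (t.target x).PoolBdd (K + 1)
    · rw [cutoff_eq_one hW hin, cutoff_eq_one hWt hout] at *
      simpa using hlayer
    · have hK : x ∉ box M (D.n + 1) K := fun h => hout (t.poolBdd_target h.2)
      have hrate : D.jumpRate p b t x ≤ D.joinBound t := by
        rcases t with ⟨i, j⟩ | ⟨k, i, j⟩ | ⟨i, j⟩ | ⟨β, i, j⟩ | ⟨β, i, j⟩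
        · exact absurd hin hout
        · exact absurd hin hout
        · exact absurd hin hout
        · exact mul_le_of_le_one_right
            (mul_nonneg (D.crowdRate_nonneg β i) (D.crowdProb_nonneg β i j))
            (b.join_le_one x β i j)
        · refine absurd (fun γ a c => ?_) hout
          simp only [Jump.target, State.crowdExit_pool]
          exact (Nat.sub_le _ _).trans (hin γ a c)
      rw [cutoff_eq_one hW hin, cutoff_eq_zero fun h => hout h.2, cutoff_eq_zero hK]
      norm_num
      linarith
  · have h0 : cutoff M (D.n + 1) (K + 1) x = 0 := cutoff_eq_zero fun h => hin h.2
    rw [abs_of_nonneg (by rw [h0, sub_zero]; exact cutoff_nonneg _ _ _)]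
    linarith

/-- If the drift of a function that depends on the crowdsourced drivers in a bounded way is at most
`r`, then `r` has a nonnegative stationary mean.  No regularity of the chain is needed: the test
function is multiplied by a cutoff, and the error vanishes as the cutoff is removed. -/
lemma Network.IsSteadyState.mean_nonneg_of_generator_le (hπ : D.IsSteadyState p b π)
    {θ r : State M → ℝ} {B s : ℝ} (hθ : ∀ x, x.FleetBdd (D.n + 1) → |θ x| ≤ B)
    (hle : ∀ x, x.fleet = D.n → D.generator p b θ x ≤ r x) (hr : HasMean π r s) : 0 ≤ s := by
  set u : ℕ → State M → ℝ := cutoff M (D.n + 1) with hu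
  set C : ℝ := ∑ t, D.joinBound t with hC
  have hpt : ∀ K x, x.fleet = D.n →
      D.generator p b (fun y => u (K + 1) y * θ y) x
        ≤ u (K + 1) x * r x
          + B * (D.generator p b (u (K + 1)) x + 2 * C * (u (K + 1) x - u K x)) := by
    intro K x hx
    have hB : 0 ≤ B := (abs_nonneg _).trans (hθ x fun i j => by
      have := x.fleetBdd_fleet i j
      omega)
    have h1 : D.generator p b (fun y => u (K + 1) y * θ y) x
        ≤ u (K + 1) x * D.generator p b θ x
          + B * ∑ t, D.jumpRate p b t x * |u (K + 1) (t.target x) - u (K + 1) x| := by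
      rw [D.generator_eq, D.generator_eq, Finset.mul_sum, Finset.mul_sum,
        ← Finset.sum_add_distrib]
      refine Finset.sum_le_sum fun t _ => ?_
      have hθt : |θ (t.target x)| ≤ B :=
        hθ _ (t.fleetBdd_target (hx ▸ x.fleetBdd_fleet))
      have h2 : θ (t.target x) * (u (K + 1) (t.target x) - u (K + 1) x)
          ≤ B * |u (K + 1) (t.target x) - u (K + 1) x| := by
        refine (le_abs_self _).trans ?_
        rw [abs_mul]
        exact mul_le_mul_of_nonneg_right hθt (abs_nonneg _)
      have h3 := mul_le_mul_of_nonneg_left h2 (D.jumpRate_nonneg p b t x)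
      linarith
    have h4 : ∑ t, D.jumpRate p b t x * |u (K + 1) (t.target x) - u (K + 1) x|
        ≤ D.generator p b (u (K + 1)) x + 2 * C * (u (K + 1) x - u K x) := by
      rw [D.generator_eq, hC, Finset.mul_sum, Finset.sum_mul, ← Finset.sum_add_distrib]
      exact Finset.sum_le_sum fun t _ => D.jumpRate_mul_abs_cutoff_le hx K t
    have h5 := mul_le_mul_of_nonneg_left (hle x hx) (cutoff_nonneg (D.n + 1) (K + 1) x)
    have h6 := mul_le_mul_of_nonneg_left h4 hB
    linarith
  have hW : ∀ x, π x ≠ 0 → x.FleetBdd (D.n + 1) := fun x hx i j => by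
    have := x.fleetBdd_fleet i j
    rw [hπ.closed x hx] at this
    omega
  have hbound : ∀ (f : State M → ℝ) (K : ℕ) (x : State M),
      ‖π x * (u K x * f x)‖ ≤ |π x * f x| := by
    intro f K x
    rw [Real.norm_eq_abs, mul_left_comm, abs_mul, abs_of_nonneg (cutoff_nonneg _ _ _)]
    exact mul_le_of_le_one_left (abs_nonneg _) (cutoff_le_one _ _ _)
  have hsum : ∀ {f : State M → ℝ} {m : ℝ}, HasMean π f m → ∀ K,
      HasMean π (fun x => u K x * f x) (∑' x, π x * (u K x * f x)) := fun hf K =>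
    (Summable.of_norm_bounded hf.summable.abs (hbound _ K)).hasSum
  have hlim : ∀ {f : State M → ℝ} {m : ℝ}, HasMean π f m →
      Tendsto (fun K => ∑' x, π x * (u K x * f x)) atTop (𝓝 m) := by
    intro f m hf
    rw [← hf.tsum_eq]
    refine tendsto_tsum_of_dominated_convergence hf.summable.abs (fun x => ?_)
      (Eventually.of_forall fun K x => hbound f K x)
    by_cases hx : π x = 0
    · simp [hx]
    · simpa using ((tendsto_cutoff (hW x hx)).mul_const (f x)).const_mul (π x)
  have hone := hπ.hasMean_const 1
  have hK : ∀ K, 0 ≤ (∑' x, π x * (u (K + 1) x * r x))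
      + B * (0 + 2 * C * ((∑' x, π x * (u (K + 1) x * 1)) - ∑' x, π x * (u K x * 1))) := by
    intro K
    refine hπ.mean_le_mean
      (hπ.hasMean_generator (K := K + 1) (g := fun y => u (K + 1) y * θ y) fun x hx => ?_)
      ((hsum hr (K + 1)).add (((hπ.hasMean_generator (K := K + 1) (g := u (K + 1))
        fun x hx => cutoff_eq_zero hx).add
          (((hsum hone (K + 1)).sub (hsum hone K)).const_mul (2 * C))).const_mul B)) ?_
    · rw [hu]
      simp only [cutoff_eq_zero hx, zero_mul]
    · intro x hx
      simpa only [mul_one] using hpt K x hx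
  have hone1 := (hlim hone).comp (tendsto_add_atTop_nat 1)
  have htot := ((hlim hr).comp (tendsto_add_atTop_nat 1)).add
    (((tendsto_const_nhds (x := (0 : ℝ))).add
      ((hone1.sub (hlim hone)).const_mul (2 * C))).const_mul B)
  have := ge_of_tendsto' htot hK
  simpa using this

/-- If `θ` depends on the crowdsourced drivers in a bounded way and has drift `r`, then the
stationary mean of `r` vanishes. -/
lemma Network.IsSteadyState.mean_eq_zero_of_generator_eq (hπ : D.IsSteadyState p b π)
    {θ r : State M → ℝ} {B s : ℝ} (hθ : ∀ x, x.FleetBdd (D.n + 1) → |θ x| ≤ B)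
    (heq : ∀ x, x.fleet = D.n → D.generator p b θ x = r x) (hr : HasMean π r s) : s = 0 := by
  refine le_antisymm ?_ (hπ.mean_nonneg_of_generator_le hθ (fun x hx => (heq x hx).le) hr)
  have := hπ.mean_nonneg_of_generator_le (θ := fun x => -θ x) (r := fun x => -1 * r x)
    (fun x hx => by rw [abs_neg]; exact hθ x hx)
    (fun x hx => by rw [D.generator_neg, heq x hx]; linarith) (hr.const_mul (-1))
  linarith

/-! ### Drifts of the counting functions -/

lemma mul_decr_sub {g : M → M → ℕ} {i j : M} {c : ℝ} (hc : g i j = 0 → c = 0) (a a' : M) :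
    c * ((decr g i j a a' : ℝ) - g a a') = -(if a = i ∧ a' = j then c else 0) := by
  rw [decr_apply]
  split_ifs with h
  · obtain ⟨rfl, rfl⟩ := h
    rcases Nat.eq_zero_or_pos (g a a') with h0 | h0
    · simp [hc h0]
    · rw [Nat.cast_sub h0]
      push_cast
      ring
  · simp

lemma mul_incr_sub (g : M → M → ℕ) (i j : M) (c : ℝ) (a a' : M) :
    c * ((incr g i j a a' : ℝ) - g a a') = if a = i ∧ a' = j then c else 0 := by
  rw [incr_apply]
  split_ifs with h <;> simp

lemma Network.generator_F (x : State M) (a c : M) :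
    D.generator p b (fun y => (y.F a c : ℝ)) x
      = D.reqRate a * D.reqProb a c * p.matchFD x a - D.mu a c * x.F a c := by
  have h1 : ∀ i j, D.reqRate i * D.reqProb i j * p.matchFD x i
      * (((x.startService i j).F a c : ℝ) - x.F a c)
      = if a = i ∧ c = j then D.reqRate i * D.reqProb i j * p.matchFD x i else 0 :=
    fun i j => mul_incr_sub x.F i j _ a c
  have h2 : ∀ k i j, D.mu k i * x.F k i * p.Q x i j
      * (((x.endService k i j).F a c : ℝ) - x.F a c)
      = -(if a = k ∧ c = i then D.mu k i * x.F k i * p.Q x i j else 0) :=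
    fun k i j => mul_decr_sub (fun h => by simp [h]) a c
  simp only [Network.generator, h1, h2]
  simp only [State.endRelocation, State.crowdExit, State.crowdJoin, sub_self, mul_zero,
    Finset.sum_const_zero, add_zero, ite_and, Finset.sum_neg_distrib]
  simp only [Finset.sum_ite_irrel, Finset.sum_const_zero, Finset.sum_ite_eq, Finset.mem_univ,
    if_true, ← Finset.mul_sum, p.Q_sum, mul_one]
  ring

lemma Network.generator_E (x : State M) (a c : M) :
    D.generator p b (fun y => (y.E a c : ℝ)) x
      = ∑ k, D.mu k a * x.F k a * p.Q x a c
        + (if a = c then ∑ k with k ≠ a, D.mu k a * x.E k a - D.reqRate a * p.matchFD x a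
          else -(D.mu a c * x.E a c)) := by
  have h1 : ∀ i j, D.reqRate i * D.reqProb i j * p.matchFD x i
      * (((x.startService i j).E a c : ℝ) - x.E a c)
      = -(if a = i ∧ c = i then D.reqRate i * D.reqProb i j * p.matchFD x i else 0) :=
    fun i j => mul_decr_sub (fun h => by simp [p.matchFD_idle x i h]) a c
  have h2 : ∀ k i j, D.mu k i * x.F k i * p.Q x i j
      * (((x.endService k i j).E a c : ℝ) - x.E a c)
      = if a = i ∧ c = j then D.mu k i * x.F k i * p.Q x i j else 0 :=
    fun k i j => mul_incr_sub x.E i j _ a c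
  have h3 : ∀ i j, D.mu i j * x.E i j * (((x.endRelocation i j).E a c : ℝ) - x.E a c)
      = (if a = j ∧ c = j then D.mu i j * x.E i j else 0)
        - (if a = i ∧ c = j then D.mu i j * x.E i j else 0) := by
    intro i j
    have hi := mul_incr_sub (decr x.E i j) j j (D.mu i j * x.E i j) a c
    have hd := mul_decr_sub (g := x.E) (i := i) (j := j) (c := D.mu i j * x.E i j)
      (fun h => by simp [h]) a c
    simp only [State.endRelocation]
    linarith
  simp only [Network.generator, h1, h2, h3]
  simp only [State.crowdExit, State.crowdJoin, sub_self, mul_zero,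
    Finset.sum_const_zero, add_zero, ite_and, Finset.sum_neg_distrib]
  simp only [Finset.sum_filter, Finset.sum_sub_distrib, Finset.sum_ite_irrel,
    Finset.sum_const_zero, Finset.sum_ite_eq, Finset.mem_univ, if_true]
  by_cases hac : a = c
  · subst hac
    have hP : ∑ j, D.reqRate a * D.reqProb a j * p.matchFD x a = D.reqRate a * p.matchFD x a := by
      rw [← Finset.sum_mul, ← Finset.mul_sum, D.reqProb_sum, mul_one]
    simp only [hP, if_true, Finset.mem_filter, Finset.mem_univ, true_and, ne_eq, not_true_eq_false,
      if_false, sub_zero, eq_comm (a := a)]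
    ring
  · have hca : c ≠ a := fun h => hac h.symm
    simp [hac, hca]

/-- The number of drivers that are at the location `a` without a request, or have left it without
one, changes by the flows into `a` and out of `a`. -/
lemma Network.generator_sum_E (x : State M) (a : M) :
    D.generator p b (fun y => ∑ c, (y.E a c : ℝ)) x
      = ∑ k, D.mu k a * x.F k a + ∑ k with k ≠ a, D.mu k a * x.E k a
        - D.reqRate a * p.matchFD x a - ∑ c with c ≠ a, D.mu a c * x.E a c := by
  have hQ : ∑ c, ∑ k, D.mu k a * x.F k a * p.Q x a c = ∑ k, D.mu k a * x.F k a := by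
    rw [Finset.sum_comm]
    simp only [← Finset.mul_sum, p.Q_sum, mul_one]
  rw [D.generator_sum p b Finset.univ (fun c (y : State M) => (y.E a c : ℝ))]
  simp only [D.generator_E]
  have hE : ∑ c, (if a = c then
        ∑ k with k ≠ a, D.mu k a * x.E k a - D.reqRate a * p.matchFD x a
      else -(D.mu a c * x.E a c))
      = ∑ k with k ≠ a, D.mu k a * x.E k a - D.reqRate a * p.matchFD x a
        - ∑ c with c ≠ a, D.mu a c * x.E a c := by
    rw [← Finset.add_sum_erase Finset.univ _ (Finset.mem_univ a), if_pos rfl,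
      Finset.sum_congr rfl fun c hc => if_neg (Finset.ne_of_mem_erase hc).symm,
      Finset.sum_neg_distrib, ← Finset.filter_ne', sub_eq_add_neg _ (∑ c with c ≠ a, _)]
  rw [Finset.sum_add_distrib, hQ, hE]
  ring

/-- The drift of a truncated number of waiting crowdsourced drivers: their arrivals have a bounded
rate, and each match of one of them lowers the number unless it is above the truncation. -/
lemma Network.generator_min_pool_le (x : State M) (β : Crowd) (i j : M) (L : ℕ) :
    D.generator p b (fun y => ((min (y.pool β i j) L : ℕ) : ℝ)) x
      ≤ D.crowdRate β i * D.crowdProb β i j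
        - D.reqRate i * D.reqProb i j
          * (if x.pool β i j ≤ L then p.matchCrowd x β i j else 0) := by
  classical
  have hle : ∀ t, D.jumpRate p b t x
      * (((min ((t.target x).pool β i j) L : ℕ) : ℝ) - (min (x.pool β i j) L : ℕ))
      ≤ (if t = .inr (.inr (.inr (.inl (β, i, j)))) then
          D.crowdRate β i * D.crowdProb β i j else 0)
        + (if t = .inr (.inr (.inr (.inr (β, i, j)))) then
          -(D.reqRate i * D.reqProb i j
            * (if x.pool β i j ≤ L then p.matchCrowd x β i j else 0)) else 0) := by
    intro t
    have hr := D.jumpRate_nonneg p b t x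
    rcases t with ⟨k, l⟩ | ⟨k, l, m⟩ | ⟨k, l⟩ | ⟨γ, k, l⟩ | ⟨γ, k, l⟩
    · simp [Jump.target, State.startService]
    · simp [Jump.target, State.endService]
    · simp [Jump.target, State.endRelocation]
    · simp only [Jump.target, State.crowdJoin_pool, Sum.inr.injEq, Sum.inl.injEq, Prod.mk.injEq,
        reduceCtorEq, if_false, add_zero]
      by_cases h : β = γ ∧ i = k ∧ j = l
      · obtain ⟨rfl, rfl, rfl⟩ := h
        simp only [and_self, if_true]
        have h1 : ((min (x.pool β i j + 1) L : ℕ) : ℝ) - (min (x.pool β i j) L : ℕ) ≤ 1 := by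
          rw [sub_le_iff_le_add']
          exact_mod_cast (by omega : min (x.pool β i j + 1) L ≤ min (x.pool β i j) L + 1)
        have h2 : D.crowdRate β i * D.crowdProb β i j * b.join x β i j
            ≤ D.crowdRate β i * D.crowdProb β i j :=
          mul_le_of_le_one_right (mul_nonneg (D.crowdRate_nonneg β i) (D.crowdProb_nonneg β i j))
            (b.join_le_one x β i j)
        exact (mul_le_of_le_one_right hr h1).trans h2
      · have h' : ¬ (γ = β ∧ k = i ∧ l = j) := fun h' => h ⟨h'.1.symm, h'.2.1.symm, h'.2.2.symm⟩
        simp [h, h']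
    · simp only [Jump.target, State.crowdExit_pool, Sum.inr.injEq, Prod.mk.injEq,
        reduceCtorEq, if_false, zero_add]
      by_cases h : β = γ ∧ i = k ∧ j = l
      · obtain ⟨rfl, rfl, rfl⟩ := h
        simp only [and_self, if_true]
        have hm := mul_nonneg (D.reqRate_nonneg i) (D.reqProb_nonneg i j)
        rcases Nat.eq_zero_or_pos (x.pool β i j) with h0 | h0
        · simp [h0, p.matchCrowd_pool x β i j h0]
        · split_ifs with hL
          · have h1 : ((min (x.pool β i j - 1) L : ℕ) : ℝ) - (min (x.pool β i j) L : ℕ) = -1 := by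
              have : min (x.pool β i j) L = min (x.pool β i j - 1) L + 1 := by omega
              rw [this]
              push_cast
              ring
            rw [h1]
            simp only [Network.jumpRate]
            linarith [b.leave_nonneg x β i j]
          · have h1 : ((min (x.pool β i j - 1) L : ℕ) : ℝ) - (min (x.pool β i j) L : ℕ) ≤ 0 := by
              rw [sub_nonpos]
              exact_mod_cast min_le_min_right L (Nat.sub_le _ 1)
            simpa using mul_nonpos_of_nonneg_of_nonpos hr h1
      · have h' : ¬ (γ = β ∧ k = i ∧ l = j) := fun h' => h ⟨h'.1.symm, h'.2.1.symm, h'.2.2.symm⟩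
        simp [h, h']
  rw [D.generator_eq]
  refine (Finset.sum_le_sum fun t _ => hle t).trans_eq ?_
  have hone : ∀ (t₀ : Jump M) (c : ℝ), ∑ t, (if t = t₀ then c else 0) = c := fun t₀ c => by
    exact (Finset.sum_eq_single t₀ (fun t _ ht => if_neg ht)
      fun h => absurd (Finset.mem_univ t₀) h).trans (if_pos rfl)
  rw [Finset.sum_add_distrib, hone, hone]
  ring

/-! ### The stationary means are feasible -/

lemma Policy.sum_matchCrowd (p : Policy M) (x : State M) (i j : M) (g : Crowd → ℝ) :
    ∑ β, g β * p.matchCrowd x β i j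
      = g .gigWorker * p.matchCrowd x .gigWorker i j
        + g .occasional * p.matchCrowd x .occasional i j := by
  have : (Finset.univ : Finset Crowd) = {.gigWorker, .occasional} := rfl
  rw [this, Finset.sum_pair (by decide)]

lemma Policy.matchCrowd_le_one (p : Policy M) (x : State M) (β : Crowd) (i j : M) :
    p.matchCrowd x β i j ≤ 1 := by
  have h1 := p.match_le_one x i j
  have h2 := p.matchFD_nonneg x i
  have h3 := Finset.single_le_sum (f := fun β => p.matchCrowd x β i j)
    (fun β _ => p.matchCrowd_nonneg x β i j) (Finset.mem_univ β)
  linarith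

lemma Policy.matchFD_le_one (p : Policy M) (x : State M) (i : M) : p.matchFD x i ≤ 1 := by
  have h1 := p.match_le_one x i i
  have h2 := Finset.sum_nonneg fun β (_ : β ∈ Finset.univ) => p.matchCrowd_nonneg x β i i
  linarith

/-- The point of the linear program given by a steady state: mean fractions of the fleet, and mean
matching probabilities. -/
noncomputable def Network.meanVars (D : Network M) (p : Policy M) (π : State M → ℝ) :
    FluidVars M where
  e i j := (∑' x, π x * x.E i j) / D.n
  f i j := (∑' x, π x * x.F i j) / D.n
  aFD i := ∑' x, π x * p.matchFD x i
  aCrowd β i j := D.reqProb i j * ∑' x, π x * p.matchCrowd x β i j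
  aLost i j := D.reqProb i j * (1 - (∑' x, π x * p.matchFD x i)
    - ((∑' x, π x * p.matchCrowd x .gigWorker i j)
      + ∑' x, π x * p.matchCrowd x .occasional i j))

namespace Network.IsSteadyState

lemma hasMean_E (hπ : D.IsSteadyState p b π) (i j : M) :
    HasMean π (fun x => (x.E i j : ℝ)) (D.n * (D.meanVars p π).e i j) := by
  have hn : (D.n : ℝ) ≠ 0 := Nat.cast_ne_zero.mpr D.n_pos.ne'
  rw [Network.meanVars, mul_div_cancel₀ _ hn]
  refine hπ.hasMean_tsum D.n fun x hx => ?_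
  rw [Nat.abs_cast]
  exact_mod_cast hx ▸ x.E_le_fleet i j

lemma hasMean_F (hπ : D.IsSteadyState p b π) (i j : M) :
    HasMean π (fun x => (x.F i j : ℝ)) (D.n * (D.meanVars p π).f i j) := by
  have hn : (D.n : ℝ) ≠ 0 := Nat.cast_ne_zero.mpr D.n_pos.ne'
  rw [Network.meanVars, mul_div_cancel₀ _ hn]
  refine hπ.hasMean_tsum D.n fun x hx => ?_
  rw [Nat.abs_cast]
  exact_mod_cast hx ▸ x.F_le_fleet i j

lemma hasMean_matchFD (hπ : D.IsSteadyState p b π) (i : M) :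
    HasMean π (fun x => p.matchFD x i) ((D.meanVars p π).aFD i) := by
  refine hπ.hasMean_tsum 1 fun x _ => ?_
  rw [abs_of_nonneg (p.matchFD_nonneg x i)]
  exact p.matchFD_le_one x i

lemma hasMean_matchCrowd (hπ : D.IsSteadyState p b π) (β : Crowd) (i j : M) :
    HasMean π (fun x => p.matchCrowd x β i j) (∑' x, π x * p.matchCrowd x β i j) := by
  refine hπ.hasMean_tsum 1 fun x _ => ?_
  rw [abs_of_nonneg (p.matchCrowd_nonneg x β i j)]
  exact p.matchCrowd_le_one x β i j

lemma hasMean_lost (hπ : D.IsSteadyState p b π) (i j : M) :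
    HasMean π (fun x => 1 - p.matchFD x i - ∑ β, p.matchCrowd x β i j)
      (1 - (∑' x, π x * p.matchFD x i) - ((∑' x, π x * p.matchCrowd x .gigWorker i j)
        + ∑' x, π x * p.matchCrowd x .occasional i j)) := by
  have h : ∀ x, ∑ β, p.matchCrowd x β i j
      = p.matchCrowd x .gigWorker i j + p.matchCrowd x .occasional i j := fun x => by
    simpa using p.sum_matchCrowd x i j 1
  simp only [h]
  exact ((hπ.hasMean_const 1).sub (hπ.hasMean_matchFD i)).sub
    ((hπ.hasMean_matchCrowd .gigWorker i j).add (hπ.hasMean_matchCrowd .occasional i j))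

/-- The matches of crowdsourced drivers are at most as frequent as their arrivals.  The number of
waiting drivers may have an infinite mean, so it is truncated first. -/
lemma mean_matchCrowd_le (hπ : D.IsSteadyState p b π) (β : Crowd) (i j : M) :
    D.reqRate i * D.reqProb i j * ∑' x, π x * p.matchCrowd x β i j
      ≤ D.crowdRate β i * D.crowdProb β i j := by
  have hL : ∀ L : ℕ, D.reqRate i * D.reqProb i j
      * ∑' x, π x * (if x.pool β i j ≤ L then p.matchCrowd x β i j else 0)
      ≤ D.crowdRate β i * D.crowdProb β i j := by
    intro L
    have hmean : HasMean π (fun x => if x.pool β i j ≤ L then p.matchCrowd x β i j else 0)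
        (∑' x, π x * (if x.pool β i j ≤ L then p.matchCrowd x β i j else 0)) := by
      refine hπ.hasMean_tsum 1 fun x _ => ?_
      split_ifs
      · rw [abs_of_nonneg (p.matchCrowd_nonneg x β i j)]
        exact p.matchCrowd_le_one x β i j
      · simp
    have := hπ.mean_nonneg_of_generator_le (B := L)
      (θ := fun y => ((min (y.pool β i j) L : ℕ) : ℝ))
      (fun x _ => by rw [Nat.abs_cast]; exact_mod_cast min_le_right _ _)
      (fun x _ => D.generator_min_pool_le x β i j L)
      ((hπ.hasMean_const _).sub (hmean.const_mul _))
    linarith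
  have hlim : Tendsto
      (fun L : ℕ => ∑' x, π x * (if x.pool β i j ≤ L then p.matchCrowd x β i j else 0)) atTop
      (𝓝 (∑' x, π x * p.matchCrowd x β i j)) := by
    refine tendsto_tsum_of_dominated_convergence hπ.hasSum_one.summable (fun x => ?_)
      (Eventually.of_forall fun L x => ?_)
    · refine tendsto_const_nhds.congr' ?_
      filter_upwards [eventually_ge_atTop (x.pool β i j)] with L hx
      rw [if_pos hx]
    · rw [Real.norm_eq_abs, abs_mul, abs_of_nonneg (hπ.nonneg x)]
      refine mul_le_of_le_one_right (hπ.nonneg x) ?_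
      split_ifs
      · rw [abs_of_nonneg (p.matchCrowd_nonneg x β i j)]
        exact p.matchCrowd_le_one x β i j
      · simp
  exact le_of_tendsto' (hlim.const_mul _) hL

lemma meanVars_little_fd (hπ : D.IsSteadyState p b π) (i j : M) :
    D.reqRate i * (D.meanVars p π).aFD i * D.reqProb i j
      = D.n * (D.mu i j * (D.meanVars p π).f i j) := by
  have := hπ.mean_eq_zero_of_generator_eq (B := (D.n + 1 : ℕ)) (θ := fun y => (y.F i j : ℝ))
    (fun x hx => by rw [Nat.abs_cast]; exact_mod_cast (hx i j).2)
    (fun x _ => D.generator_F x i j)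
    (((hπ.hasMean_matchFD i).const_mul (D.reqRate i * D.reqProb i j)).sub
      ((hπ.hasMean_F i j).const_mul (D.mu i j)))
  linarith

lemma meanVars_flow_relocate (hπ : D.IsSteadyState p b π) {i j : M} (hij : i ≠ j) :
    D.mu i j * (D.meanVars p π).e i j ≤ ∑ k, D.mu k i * (D.meanVars p π).f k i := by
  have h := hπ.mean_nonneg_of_generator_le (B := (D.n + 1 : ℕ)) (θ := fun y => (y.E i j : ℝ))
    (fun x hx => by rw [Nat.abs_cast]; exact_mod_cast (hx i j).1)
    (fun x _ => by
      rw [D.generator_E x i j, if_neg hij, ← sub_eq_add_neg]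
      refine sub_le_sub_right (Finset.sum_le_sum fun k _ => mul_le_of_le_one_right
        (mul_nonneg (D.mu_pos k i).le (Nat.cast_nonneg _)) ?_) _
      rw [← p.Q_sum x i]
      exact Finset.single_le_sum (fun c _ => p.Q_nonneg x i c) (Finset.mem_univ j))
    ((HasMean.sum fun k _ => (hπ.hasMean_F k i).const_mul (D.mu k i)).sub
      ((hπ.hasMean_E i j).const_mul (D.mu i j)))
  simp only [mul_left_comm (D.mu _ _) (D.n : ℝ), ← Finset.mul_sum, ← mul_sub] at h
  have := nonneg_of_mul_nonneg_right h (Nat.cast_pos.mpr D.n_pos)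
  linarith

lemma meanVars_flow_lower (hπ : D.IsSteadyState p b π) (i : M) :
    D.n * ∑ k with k ≠ i, D.mu k i * (D.meanVars p π).e k i
      ≤ D.reqRate i * (D.meanVars p π).aFD i := by
  have h := hπ.mean_nonneg_of_generator_le (B := (D.n + 1 : ℕ)) (θ := fun y => -(y.E i i : ℝ))
    (fun x hx => by rw [abs_neg, Nat.abs_cast]; exact_mod_cast (hx i i).1)
    (r := fun x => D.reqRate i * p.matchFD x i - ∑ k with k ≠ i, D.mu k i * x.E k i)
    (fun x _ => by
      rw [D.generator_neg, D.generator_E x i i, if_pos rfl]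
      have : 0 ≤ ∑ k, D.mu k i * x.F k i * p.Q x i i := Finset.sum_nonneg fun k _ =>
        mul_nonneg (mul_nonneg (D.mu_pos k i).le (Nat.cast_nonneg _)) (p.Q_nonneg x i i)
      linarith)
    (((hπ.hasMean_matchFD i).const_mul (D.reqRate i)).sub
      (HasMean.sum fun k _ => (hπ.hasMean_E k i).const_mul (D.mu k i)))
  simp only [mul_left_comm (D.mu _ _) (D.n : ℝ), ← Finset.mul_sum] at h
  linarith

lemma meanVars_flow_balance (hπ : D.IsSteadyState p b π) (i : M) :
    D.reqRate i * (D.meanVars p π).aFD i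
        + D.n * ∑ j with j ≠ i, D.mu i j * (D.meanVars p π).e i j
      = D.n * ∑ k with k ≠ i, D.mu k i * (D.meanVars p π).e k i
        + D.n * ∑ k, D.mu k i * (D.meanVars p π).f k i := by
  have h := hπ.mean_eq_zero_of_generator_eq (B := ∑ _c : M, ((D.n + 1 : ℕ) : ℝ))
    (θ := fun y => ∑ c, (y.E i c : ℝ))
    (fun x hx => by
      rw [abs_of_nonneg (Finset.sum_nonneg fun c _ => Nat.cast_nonneg _)]
      exact Finset.sum_le_sum fun c _ => by exact_mod_cast (hx i c).1)
    (fun x _ => D.generator_sum_E x i)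
    ((((HasMean.sum fun k _ => (hπ.hasMean_F k i).const_mul (D.mu k i)).add
      (HasMean.sum fun k _ => (hπ.hasMean_E k i).const_mul (D.mu k i))).sub
      ((hπ.hasMean_matchFD i).const_mul (D.reqRate i))).sub
      (HasMean.sum fun k _ => (hπ.hasMean_E i k).const_mul (D.mu i k)))
  simp only [mul_left_comm (D.mu _ _) (D.n : ℝ), ← Finset.mul_sum] at h
  linarith

lemma feasible_meanVars (hπ : D.IsSteadyState p b π) : D.Feasible (D.meanVars p π) := by
  have hn : (0 : ℝ) < D.n := Nat.cast_pos.mpr D.n_pos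
  have hcrowd0 : ∀ β i j, 0 ≤ ∑' x, π x * p.matchCrowd x β i j := fun β i j =>
    tsum_nonneg fun x => mul_nonneg (hπ.nonneg x) (p.matchCrowd_nonneg x β i j)
  have hcrowd1 : ∀ β i j, ∑' x, π x * p.matchCrowd x β i j ≤ 1 := fun β i j =>
    hπ.mean_le_mean (hπ.hasMean_matchCrowd β i j) (hπ.hasMean_const 1)
      fun x _ => p.matchCrowd_le_one x β i j
  have hfd0 : ∀ i, 0 ≤ (D.meanVars p π).aFD i := fun i =>
    tsum_nonneg fun x => mul_nonneg (hπ.nonneg x) (p.matchFD_nonneg x i)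
  have hE0 : ∀ i j, 0 ≤ (D.meanVars p π).e i j := fun i j =>
    div_nonneg (tsum_nonneg fun x => mul_nonneg (hπ.nonneg x) (Nat.cast_nonneg _)) hn.le
  have hF0 : ∀ i j, 0 ≤ (D.meanVars p π).f i j := fun i j =>
    div_nonneg (tsum_nonneg fun x => mul_nonneg (hπ.nonneg x) (Nat.cast_nonneg _)) hn.le
  have hbal : ∀ i, (D.reqRate i / D.n) * (D.meanVars p π).aFD i
        + ∑ j with j ≠ i, D.mu i j * (D.meanVars p π).e i j
      = ∑ k with k ≠ i, D.mu k i * (D.meanVars p π).e k i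
        + ∑ k, D.mu k i * (D.meanVars p π).f k i := by
    intro i
    have := hπ.meanVars_flow_balance i
    rw [div_mul_eq_mul_div, div_add' _ _ _ hn.ne', div_eq_iff hn.ne']
    linarith
  constructor
  · intro i j
    rw [div_mul_eq_mul_div, div_mul_eq_mul_div, div_eq_iff hn.ne', hπ.meanVars_little_fd i j]
    ring
  · intro β i j
    have := hπ.mean_matchCrowd_le β i j
    simpa only [Network.meanVars, mul_assoc] using this
  · exact fun i j hij => hπ.meanVars_flow_relocate hij
  · intro i
    rw [div_mul_eq_mul_div, le_div_iff₀ hn, mul_comm]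
    exact hπ.meanVars_flow_lower i
  · intro i
    rw [← hbal i]
    exact le_add_of_nonneg_right (Finset.sum_nonneg fun j _ =>
      mul_nonneg (D.mu_pos i j).le (hE0 i j))
  · exact hbal
  · intro i
    have h : ∀ j, (D.meanVars p π).aCrowd .gigWorker i j + (D.meanVars p π).aCrowd .occasional i j
        + (D.meanVars p π).aLost i j = D.reqProb i j * (1 - (D.meanVars p π).aFD i) := by
      intro j
      simp only [Network.meanVars]
      ring
    simp only [h, ← Finset.sum_mul, D.reqProb_sum]
    ring
  · exact fun i => ⟨hfd0 i, hπ.mean_le_mean (hπ.hasMean_matchFD i) (hπ.hasMean_const 1)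
      fun x _ => p.matchFD_le_one x i⟩
  · exact fun β i j => ⟨mul_nonneg (D.reqProb_nonneg i j) (hcrowd0 β i j),
      mul_le_of_le_one_right (D.reqProb_nonneg i j) (hcrowd1 β i j)⟩
  · intro i j
    refine ⟨mul_nonneg (D.reqProb_nonneg i j) (hπ.mean_le_mean (hπ.hasMean_const 0)
      (hπ.hasMean_lost i j) fun x _ => ?_), mul_le_one₀ (D.reqProb_le_one i j)
      (hπ.mean_le_mean (hπ.hasMean_const 0) (hπ.hasMean_lost i j) fun x _ => ?_)
      (hπ.mean_le_mean (hπ.hasMean_lost i j) (hπ.hasMean_const 1) fun x _ => ?_)⟩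
    · linarith [p.match_le_one x i j]
    · linarith [p.match_le_one x i j]
    · have h1 := p.matchFD_nonneg x i
      have h2 := Finset.sum_nonneg fun β (_ : β ∈ Finset.univ) => p.matchCrowd_nonneg x β i j
      linarith
  · refine fun i j => ⟨hE0 i j, ?_⟩
    have := hπ.mean_le_mean (hπ.hasMean_E i j) (hπ.hasMean_const D.n) fun x hx => by
      exact_mod_cast hx ▸ x.E_le_fleet i j
    exact le_of_mul_le_mul_left (by simpa using this) hn
  · refine fun i j => ⟨hF0 i j, ?_⟩
    have := hπ.mean_le_mean (hπ.hasMean_F i j) (hπ.hasMean_const D.n) fun x hx => by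
      exact_mod_cast hx ▸ x.F_le_fleet i j
    exact le_of_mul_le_mul_left (by simpa using this) hn
  · have hfleet : ∀ x : State M, x.fleet = D.n →
        ∑ i, ∑ j, ((x.E i j : ℝ) + x.F i j) = D.n := fun x hx => by
      rw [← hx, State.fleet]
      push_cast
      rfl
    have hmean := HasMean.sum (t := Finset.univ) fun i (_ : i ∈ Finset.univ) =>
      HasMean.sum (t := Finset.univ) fun j (_ : j ∈ Finset.univ) =>
        (hπ.hasMean_E i j).add (hπ.hasMean_F i j)
    have htot := le_antisymm
      (hπ.mean_le_mean hmean (hπ.hasMean_const D.n) fun x hx => (hfleet x hx).le)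
      (hπ.mean_le_mean (hπ.hasMean_const D.n) hmean fun x hx => (hfleet x hx).ge)
    simp only [← mul_add, ← Finset.mul_sum] at htot
    exact mul_left_cancel₀ hn.ne' (by rw [htot, mul_one])

/-- The objective of the linear program is the cost of the steady state. -/
lemma objective_meanVars (hπ : D.IsSteadyState p b π) :
    D.objective (D.meanVars p π) = D.operationalCost p π := by
  have h : HasMean π (D.costRate p) (D.objective (D.meanVars p π)) := by
    refine HasMean.sum fun i _ => HasMean.sum fun j _ => ?_
    have hrel : HasMean π (fun x => if i = j then 0 else D.costFD i j * (x.E i j : ℝ))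
        ((1 - if i = j then 1 else 0) * D.costFD i j * D.n * (D.meanVars p π).e i j) := by
      split_ifs
      · simpa using hπ.hasMean_const 0
      · simpa only [sub_zero, one_mul, mul_assoc] using
          (hπ.hasMean_E i j).const_mul (D.costFD i j)
    have hmatch := ((((hπ.hasMean_matchFD i).const_mul (D.costFD i j)).add
      (((hπ.hasMean_matchCrowd .gigWorker i j).const_mul (D.costCrowd .gigWorker i j)).add
        ((hπ.hasMean_matchCrowd .occasional i j).const_mul (D.costCrowd .occasional i j)))).add
      ((hπ.hasMean_lost i j).const_mul (D.costLost i j))).const_mul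
        (D.reqRate i * D.reqProb i j)
    have hall := hmatch.add hrel
    simp only [← p.sum_matchCrowd _ i j fun β => D.costCrowd β i j] at hall
    convert hall using 1
    simp only [Network.meanVars]
    ring
  exact h.tsum_eq.symm

end Network.IsSteadyState

end Chain

end DeliveryNetwork

theorem proposition1 {M : Type*} [Fintype M] [DecidableEq M] [Nonempty M] :
    -- every network: the fluid optimum exists and bounds every steady-state cost from below
    (∀ D : Network M, ∃ v : ℝ, D.IsFluidOptimum v ∧
      ∀ (p : Policy M) (b : CrowdBehaviour M) (π : State M → ℝ),
        D.IsSteadyState p b π → v ≤ D.operationalCost p π) ∧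
    -- the asymptotic regime
    (∀ (D : ℕ → Network M) (v : ℕ → ℝ) (p : ℕ → Policy M) (b : ℕ → CrowdBehaviour M)
      (π : ℕ → State M → ℝ),
      Tendsto (fun m => (D m).n) atTop atTop →
      (∀ i, Tendsto (fun m => (D m).reqRate i) atTop atTop) →
      (∀ m, (D m).IsFluidOptimum (v m)) →
      (∀ m, (D m).IsSteadyState (p m) (b m) (π m)) →
      ∀ᶠ m in atTop, v m ≤ (D m).operationalCost (p m) (π m)) := by
  have hle : ∀ (D : Network M) (v : ℝ), D.IsFluidOptimum v →
      ∀ (p : Policy M) (b : CrowdBehaviour M) (π : State M → ℝ),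
        D.IsSteadyState p b π → v ≤ D.operationalCost p π :=
    fun D v hv p b π hπ => hv.2 ⟨D.meanVars p π, hπ.feasible_meanVars, hπ.objective_meanVars⟩
  refine ⟨fun D => ?_, fun D v p b π _ _ hv hπ =>
    Eventually.of_forall fun m => hle (D m) (v m) (hv m) (p m) (b m) (π m) (hπ m)⟩
  obtain ⟨v, hv⟩ := D.exists_isFluidOptimum
  exact ⟨v, hv, hle D v hv⟩
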